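/- Let $\Lambda$ be a finite lattice with a metric $d$, and let each site $z\in\Lambda$ carry a finite-dimensional Hilbert space $\mathcal H_z$. For $V\subset\Lambda$ put $\mathcal H_V=\bigotimes_{z\in V}\mathcal H_z$, $\mathcal H=\mathcal H_\Lambda$, and regard $\mathcal B(\mathcal H_V)$ as a subset of $\mathcal B(\mathcal H)$ via $A\mapsto A\otimes 1$. $\|O\|$ is the operator norm on $\mathcal B(\mathcal H)$, and for super-operators $T\in\mathcal B(\mathcal B(\mathcal H))$, $\|T\|=\sup_{O\in\mathcal B(\mathcal H),\,O\neq0}\|TO\|/\|O\|$. Let $\mathbb L_V$ be the set of Liouvillians with support $V$, i.e. the super-operators $$O\mapsto i[H,O]+\sum_\nu\Big(L_\nu^\dagger OL_\nu-\tfrac12\big(L_\nu^\dagger L_\nu O+OL_\nu^\dagger L_\nu\big)\Big)$$ on $\mathcal B(\mathcal H)$, with a finite sum, and with $H=H^\dagger$ and all $L_\nu$ in $\mathcal B(\mathcal H_V)$. Let $\mathcal L(t)=\sum_{Z\subset\Lambda}\ell_Z(t)$, $t\in\mathbb R$, with $\ell_Z(t)\in\mathbb L_Z$. Write $\ell_Z\neq0$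 if $\ell_Z(t)\ne0$ for some $t$, and set $$\|\ell\|=\sup_{t\in\mathbb R,\,Z\subset\Lambda}\|\ell_Z(t)\|,\qquad a=\sup_{Z:\ell_Z\neq0}\operatorname{diam}(Z),\qquad \mathcal Z=\max_{Z:\ell_Z\ne0}\big|\{Z'\subset\Lambda : \ell_{Z'}\ne0,\ Z'\cap Z\ne\varnothing\}\big|,$$ where $\|\ell\|<\infty$ is assumed. For $V\subset\Lambda$ let $\bar V=\bigcup_{Z:\ell_Z\neq0,\,Z\cap V\ne\varnothing}Z$ and $|V|=\#\{Z\subset V : \ell_Z\neq0\}$. Let $\tau(s,t)$, $s\le t$, be the propagator of $\mathcal L$, i.e. the solution of $\partial_s\tau(s,t)=-\mathcal L(s)\tau(s,t)$, $\tau(t,t)=\mathrm{id}$. For $X,Y\subset\Lambda$ put $$d(X,Y)=\inf_{x\in X,\,y\in Y}d(x,y),\qquad v=e\,\mathcal Z\,\|\ell\|,\qquad \mathcal V_{X,Y}=\min\Big\{\frac{|\bar X|}{\mathcal Z},\frac{|\bar Y|}{\mathcal Z}\Big\}.$$ Let $X,Y\subset\Lambda$ be such that $X\cap Y=\varnothing$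 or $\mathcal V_{X,Y}\ge1$. Then for all $K_X\in\mathbb L_X$, all $O_Y\in\mathcal B(\mathcal H_Y)$ and all $r\le t$, $$\|K_X\,\tau(r,t)\,O_Y\|\le \mathcal V_{X,Y}\,\|K_X\|\,\|O_Y\|\,e^{v(t-r)-d(X,Y)/a}.$$ Conventions in degenerate cases: if no $\ell_Z$ is nonzero, then $a=0$, $\mathcal Z=0$ and $\mathcal V_{X,Y}=0$; if $a=0$, then $e^{-d(X,Y)/a}$ is read as $0$ when $X\cap Y=\varnothing$ and as $1$ otherwise. -/

import Mathlib

namespace MarkovLattice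

/-- Bounded linear operators on a normed space, with the operator norm. -/
abbrev BddOp (E : Type*) [NormedAddCommGroup E] [NormedSpace ℂ E] : Type _ := E →L[ℂ] E

/-- Basis labels of the subsystem `V`; the site `z` carries the Hilbert space `ℂ^(ι z)`. -/
abbrev Config {Λ : Type*} (ι : Λ → Type*) (V : Finset Λ) : Type _ := (z : V) → ι z

/-- The Hilbert space `⨂_{z ∈ V} ℂ^(ι z)` of the subsystem `V`, in its product basis. -/
abbrev SubHilb {Λ : Type*} (ι : Λ → Type*) (V : Finset Λ) : Type _ :=
  EuclideanSpace ℂ (Config ι V)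

/-- The Hilbert space `⨂_{z} ℂ^(ι z)` of the whole lattice, in its product basis. -/
abbrev Hilb {Λ : Type*} (ι : Λ → Type*) : Type _ := EuclideanSpace ℂ ((z : Λ) → ι z)

/-- Operators `B(H)` on the whole system, with the operator norm. -/
abbrev Op {Λ : Type*} [Fintype Λ] [DecidableEq Λ] (ι : Λ → Type*) [∀ z, Fintype (ι z)] :
    Type _ :=
  BddOp (Hilb ι)

/-- Super-operators `B(B(H))`, with the norm `sup ‖T O‖ / ‖O‖` over all `O ∈ B(H)`. -/
abbrev SuperOp {Λ : Type*} [Fintype Λ] [DecidableEq Λ] (ι : Λ → Type*)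
    [∀ z, Fintype (ι z)] : Type _ :=
  BddOp (Op ι)

section

variable {Λ : Type*} [Fintype Λ] [DecidableEq Λ] {ι : Λ → Type*} [∀ z, Fintype (ι z)]
  [∀ z, DecidableEq (ι z)]

open Classical in
/-- The embedding `A ↦ A ⊗ 1` of `B(H_V)` into `B(H)`. -/
noncomputable def embed (V : Finset Λ) (A : SubHilb ι V →L[ℂ] SubHilb ι V) : Op ι :=
  Matrix.toEuclideanCLM (n := (z : Λ) → ι z) (𝕜 := ℂ) (Matrix.of fun x y =>
    if ∀ z, z ∉ V → x z = y z then
      (Matrix.toEuclideanCLM (n := Config ι V) (𝕜 := ℂ)).symm A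
        (fun z => x z) (fun z => y z)
    else 0)

/-- `O` is supported on `V`, i.e. it belongs to `B(H_V)` regarded as a subset of `B(H)`. -/
def SupportedOn (V : Finset Λ) (O : Op ι) : Prop :=
  ∃ A : SubHilb ι V →L[ℂ] SubHilb ι V, O = embed V A

/-- The Liouvillians with spatial support `V`, acting on `B(H)`: the super-operators of the
Lindblad form (in the Heisenberg picture) whose Hamiltonian and Lindblad operators are
operators on `H_V`. -/
def Liouvillians (ι : Λ → Type*) [∀ z, Fintype (ι z)] [∀ z, DecidableEq (ι z)]
    (V : Finset Λ) : Set (SuperOp ι) :=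
  {T | ∃ (h : Op ι) (m : ℕ) (L : Fin m → Op ι),
    SupportedOn V h ∧ IsSelfAdjoint h ∧ (∀ ν, SupportedOn V (L ν)) ∧
    ∀ O : Op ι, T O = Complex.I • (h * O - O * h) +
      ∑ ν, (star (L ν) * O * L ν -
        (1 / 2 : ℂ) • (star (L ν) * L ν * O + O * (star (L ν) * L ν)))}

end

section

variable {Λ : Type*} [Fintype Λ] [DecidableEq Λ] {ι : Λ → Type*} [∀ z, Fintype (ι z)]

/-- The full Liouvillian `𝓛(t) = ∑_{Z ⊆ Λ} ℓ_Z(t)`. -/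
noncomputable def totalLiouvillian (ℓ : Finset Λ → ℝ → SuperOp ι) (t : ℝ) : SuperOp ι :=
  ∑ Z : Finset Λ, ℓ Z t

/-- `τ` is the propagator of `𝓛`: `∂_s τ(s,t) = -𝓛(s) τ(s,t)` for all `s ≤ t` (one-sided
at `s = t`) and `τ(t,t) = 1`. -/
def IsPropagator (𝓛 : ℝ → SuperOp ι) (τ : ℝ → ℝ → SuperOp ι) : Prop :=
  (∀ t, τ t t = ContinuousLinearMap.id ℂ (Op ι)) ∧
  ∀ s t, s ≤ t →
    HasDerivWithinAt (fun u => τ u t) (-((𝓛 s).comp (τ s t))) (Set.Iic t) s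

/-- The norm bound `‖ℓ‖ = sup_{t, Z} ‖ℓ_Z(t)‖`. -/
noncomputable def normBound (ℓ : Finset Λ → ℝ → SuperOp ι) : ℝ :=
  ⨆ p : Finset Λ × ℝ, ‖ℓ p.1 p.2‖

/-- The range `a`: the supremum of the diameters of all `Z` with `ℓ_Z ≠ 0`. -/
noncomputable def interactionRange [MetricSpace Λ] (ℓ : Finset Λ → ℝ → SuperOp ι) : ℝ :=
  sSup {ρ | ∃ Z : Finset Λ, ℓ Z ≠ 0 ∧ ρ = Metric.diam (Z : Set Λ)}

/-- The maximum number of neighbours: the maximum over all `Z` with `ℓ_Z ≠ 0` of the number of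
`Z'` with `ℓ_{Z'} ≠ 0` that intersect `Z` (`Z` itself included). -/
noncomputable def neighborNumber (ℓ : Finset Λ → ℝ → SuperOp ι) : ℕ :=
  sSup {n | ∃ Z : Finset Λ, ℓ Z ≠ 0 ∧
    n = {Z' : Finset Λ | ℓ Z' ≠ 0 ∧ (Z' ∩ Z).Nonempty}.ncard}

/-- The extension of `V`: the union of all `Z` with `ℓ_Z ≠ 0` that intersect `V`. -/
def extension (ℓ : Finset Λ → ℝ → SuperOp ι) (V : Finset Λ) : Set Λ :=
  {z | ∃ Z : Finset Λ, ℓ Z ≠ 0 ∧ (Z ∩ V).Nonempty ∧ z ∈ Z}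

/-- The volume of `V`: the number of `Z ⊆ V` with `ℓ_Z ≠ 0`. -/
noncomputable def vol (ℓ : Finset Λ → ℝ → SuperOp ι) (V : Set Λ) : ℕ :=
  {Z : Finset Λ | (Z : Set Λ) ⊆ V ∧ ℓ Z ≠ 0}.ncard

/-- The prefactor: the minimum of the volumes of the extensions of `X` and `Y`, divided by the
maximum number of neighbours. -/
noncomputable def prefactor (ℓ : Finset Λ → ℝ → SuperOp ι) (X Y : Finset Λ) : ℝ :=
  min ((vol ℓ (extension ℓ X) : ℝ) / neighborNumber ℓ)
    ((vol ℓ (extension ℓ Y) : ℝ) / neighborNumber ℓ)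

/-- The Lieb-Robinson velocity: `e` times the maximum number of neighbours times `‖ℓ‖`. -/
noncomputable def velocity (ℓ : Finset Λ → ℝ → SuperOp ι) : ℝ :=
  Real.exp 1 * neighborNumber ℓ * normBound ℓ

end

/-- The distance `inf_{x ∈ X, y ∈ Y} d(x,y)` of two subsystems. -/
noncomputable def setDist {Λ : Type*} [MetricSpace Λ] (X Y : Finset Λ) : ℝ :=
  ⨅ p : X × Y, dist (p.1 : Λ) (p.2 : Λ)

end MarkovLattice

/-!
A Lieb-Robinson bound for Markovian lattice dynamics, by expansion over chains of interactions.

Write `F u = τ (t - u) t O`, so that `F' = 𝓛 F` and `F 0 = O`. In the derivative of `K (F u)` the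
terms `ℓ_Z` whose support misses `X` commute with `K` (`Liouvillians.comm_of_disjoint`). They
therefore act on `K (F u)` itself, and do so contractively, since a Liouvillian is a completely
positive map up to second-order terms (`firstOrderContractive_lindblad`). The other terms contribute
`K (ℓ_Z (F u))`, bounded by `‖K‖ ‖ℓ_Z (F u)‖`, where `ℓ_Z` is again a Liouvillian, now with support
`Z`. At `u = 0` there remains `K O`, which vanishes when `X` and `Y` are disjoint
(`Liouvillians.apply_eq_zero_of_disjoint`). Iterating bounds `‖K (F u)‖` by
`‖K‖ ‖O‖ ∑ N_k (‖ℓ‖ u) ^ k / k!`, with `N_k` the number of chains of `k` interaction supports from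
`X` to `Y` (`norm_apply_le_chainBound`).

For disjoint `X` and `Y`, counting chains from either end gives `N_k ≤ 𝒱 𝒵 ^ k`
(`chainCount_le_of_disjoint`), and `N_k = 0` unless `d(X,Y) ≤ k a`. Hence
`N_k ≤ 𝒱 (e 𝒵) ^ k exp (-d(X,Y) / a)`, and the series sums to the exponential in the claim. For
`a = 0` there are no chains at all. For intersecting `X` and `Y` contractivity of `τ` is enough.

The maps `t ↦ ℓ_Z(t)` are not assumed measurable, so Duhamel's formula is not available for parts of
the generator. It is replaced by a differential inequality for the norm
(`norm_le_of_hasDerivWithinAt_firstOrderContractive`), in which contractivity enters only through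
`‖x + s T x‖ ≤ (1 + C s²) ‖x‖` at each single time.
-/

namespace MarkovLattice

open scoped Finset

/-! ### Contractivity of Liouvillians -/

section Kraus

variable {H : Type*} [NormedAddCommGroup H] [InnerProductSpace ℂ H] [CompleteSpace H]

/-- The completely positive map `O ↦ ∑ Aᵢ* O Aᵢ` has norm at most that of `∑ Aᵢ* Aᵢ`; the bound on
the latter is given as a bound on its quadratic form. -/
theorem norm_kraus_le {κ : Type*} [Fintype κ] (A : κ → H →L[ℂ] H) {c : ℝ} (hc : 0 ≤ c)
    (hA : ∀ x, ∑ i, ‖A i x‖ ^ 2 ≤ c * ‖x‖ ^ 2) (O : H →L[ℂ] H) :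
    ‖∑ i, star (A i) * O * A i‖ ≤ c * ‖O‖ := by
  refine ContinuousLinearMap.opNorm_le_of_re_inner_le (by positivity) fun x y hx hy => ?_
  have hx' := hA x
  have hy' := hA y
  rw [hx, one_pow, mul_one] at hx'
  rw [hy, one_pow, mul_one] at hy'
  have key : ∀ i, RCLike.re (inner ℂ ((star (A i) * O * A i) x) y) ≤
      ‖O‖ * (‖A i x‖ * ‖A i y‖) := by
    intro i
    have h1 : inner ℂ ((star (A i) * O * A i) x) y = inner ℂ (O (A i x)) (A i y) := by
      simp [ContinuousLinearMap.star_eq_adjoint, ContinuousLinearMap.adjoint_inner_left]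
    rw [h1]
    calc RCLike.re (inner ℂ (O (A i x)) (A i y)) ≤ ‖O (A i x)‖ * ‖A i y‖ :=
          re_inner_le_norm _ _
      _ ≤ (‖O‖ * ‖A i x‖) * ‖A i y‖ := by gcongr; exact O.le_opNorm _
      _ = _ := by ring
  calc RCLike.re (inner ℂ ((∑ i, star (A i) * O * A i) x) y)
      = ∑ i, RCLike.re (inner ℂ ((star (A i) * O * A i) x) y) := by
        rw [sum_apply, sum_inner, map_sum]
    _ ≤ ∑ i, ‖O‖ * (‖A i x‖ * ‖A i y‖) := Finset.sum_le_sum fun i _ => key i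
    _ = ‖O‖ * ∑ i, ‖A i x‖ * ‖A i y‖ := by rw [Finset.mul_sum]
    _ ≤ ‖O‖ * c := by
        gcongr
        have h2 : ∑ i, ‖A i x‖ * ‖A i y‖ ≤ ∑ i, (‖A i x‖ ^ 2 + ‖A i y‖ ^ 2) / 2 :=
          Finset.sum_le_sum fun i _ => by nlinarith [sq_nonneg (‖A i x‖ - ‖A i y‖)]
        rw [← Finset.sum_div, Finset.sum_add_distrib] at h2
        linarith
    _ = c * ‖O‖ := mul_comm _ _

/-- `T` generates contractions to first order: `‖1 + s T‖ ≤ 1 + O(s²)` for `s ≥ 0`. For bounded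
`T` this amounts to `exp (s T)` being a contraction for all `s ≥ 0`, but it can be checked and
used without exponentials. -/
def FirstOrderContractive {E : Type*} [NormedAddCommGroup E] [NormedSpace ℂ E]
    (T : E →L[ℂ] E) : Prop :=
  ∃ C : ℝ, ∀ s : ℝ, 0 ≤ s → ∀ x, ‖x + (s : ℂ) • T x‖ ≤ (1 + C * s ^ 2) * ‖x‖

theorem FirstOrderContractive.zero {E : Type*} [NormedAddCommGroup E] [NormedSpace ℂ E] :
    FirstOrderContractive (0 : E →L[ℂ] E) :=
  ⟨0, fun s _ x => by simp⟩

/-- The point `x + s (S + T) x` is the midpoint of `x + 2s S x` and `x + 2s T x`. -/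
theorem FirstOrderContractive.add {E : Type*} [NormedAddCommGroup E] [NormedSpace ℂ E]
    {S T : E →L[ℂ] E} (hS : FirstOrderContractive S) (hT : FirstOrderContractive T) :
    FirstOrderContractive (S + T) := by
  obtain ⟨C, hC⟩ := hS
  obtain ⟨D, hD⟩ := hT
  refine ⟨2 * (C + D), fun s hs x => ?_⟩
  have h1 := hC (2 * s) (by positivity) x
  have h2 := hD (2 * s) (by positivity) x
  have h3 : x + (s : ℂ) • (S + T) x =
      (1 / 2 : ℂ) • ((x + ((2 * s : ℝ) : ℂ) • S x) + (x + ((2 * s : ℝ) : ℂ) • T x)) := by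
    push_cast [add_apply]
    module
  rw [h3, norm_smul]
  have h4 := norm_add_le (x + ((2 * s : ℝ) : ℂ) • S x) (x + ((2 * s : ℝ) : ℂ) • T x)
  have h5 : ‖(1 / 2 : ℂ)‖ = 1 / 2 := by norm_num
  rw [h5]
  nlinarith

theorem FirstOrderContractive.sum {E κ : Type*} [NormedAddCommGroup E] [NormedSpace ℂ E]
    (s : Finset κ) {T : κ → E →L[ℂ] E} (hT : ∀ i ∈ s, FirstOrderContractive (T i)) :
    FirstOrderContractive (∑ i ∈ s, T i) :=
  Finset.sum_induction _ FirstOrderContractive (fun _ _ => .add) .zero hT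

/-- Lindblad generators are contractive to first order. With `G = -i h - ½ ∑ L* L`, the map
`O + s T O` differs by `s² G* O G` from the completely positive map with Kraus operators `1 + s G`
and `√s L`, whose value at `1` is `1 + s² G* G`. -/
theorem firstOrderContractive_lindblad {m : ℕ} {h : H →L[ℂ] H} (hh : IsSelfAdjoint h)
    (L : Fin m → H →L[ℂ] H) (T : (H →L[ℂ] H) →L[ℂ] (H →L[ℂ] H))
    (hT : ∀ O : H →L[ℂ] H, T O = Complex.I • (h * O - O * h) +
      ∑ ν, (star (L ν) * O * L ν -
        (1 / 2 : ℂ) • (star (L ν) * L ν * O + O * (star (L ν) * L ν)))) :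
    FirstOrderContractive T := by
  set S : H →L[ℂ] H := ∑ ν, star (L ν) * L ν with hS
  set G : H →L[ℂ] H := -(Complex.I • h) - (1 / 2 : ℂ) • S with hG
  have hSs : star S = S := by simp [hS, star_sum]
  have hGs : star G = Complex.I • h - (1 / 2 : ℂ) • S := by
    simp [hG, hSs, hh.star_eq]
  have hT' : ∀ O, T O = star G * O + O * G + ∑ ν, star (L ν) * O * L ν := by
    intro O
    have h1 : ∑ ν, (star (L ν) * O * L ν -
        (1 / 2 : ℂ) • (star (L ν) * L ν * O + O * (star (L ν) * L ν))) =
        ∑ ν, star (L ν) * O * L ν - (1 / 2 : ℂ) • (S * O + O * S) := by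
      rw [Finset.sum_sub_distrib, ← Finset.smul_sum, Finset.sum_add_distrib, hS,
        Finset.sum_mul, Finset.mul_sum]
    rw [hT, h1, hGs, hG]
    simp only [sub_mul, mul_sub, mul_neg, smul_mul_assoc, mul_smul_comm]
    module
  refine ⟨2 * ‖G‖ ^ 2, fun s hs O => ?_⟩
  -- the Kraus operators `1 + s G` (at `none`) and `√s L ν`
  let A : Option (Fin m) → H →L[ℂ] H := fun o =>
    o.elim (1 + (s : ℂ) • G) fun ν => ((√s : ℝ) : ℂ) • L ν
  have hss : ((√s : ℝ) : ℂ) * ((√s : ℝ) : ℂ) = s := by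
    rw [← Complex.ofReal_mul, Real.mul_self_sqrt hs]
  have hΦ : O + (s : ℂ) • T O =
      ∑ o, star (A o) * O * A o - ((s : ℂ) ^ 2) • (star G * O * G) := by
    have h1 : ∑ ν, star (((√s : ℝ) : ℂ) • L ν) * O * (((√s : ℝ) : ℂ) • L ν) =
        (s : ℂ) • ∑ ν, star (L ν) * O * L ν := by
      rw [Finset.smul_sum]
      refine Finset.sum_congr rfl fun ν _ => ?_
      simp only [star_smul, smul_mul_assoc, mul_smul_comm, smul_smul, RCLike.star_def,
        Complex.conj_ofReal, hss]
    rw [Fintype.sum_option]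
    simp only [A, Option.elim_none, Option.elim_some]
    rw [h1, hT']
    simp only [star_add, star_one, star_smul, RCLike.star_def, Complex.conj_ofReal, add_mul,
      mul_add, one_mul, mul_one, smul_mul_assoc, mul_smul_comm]
    module
  have hre : ∀ x, RCLike.re (inner ℂ x (G x)) = -(1 / 2) * ∑ ν, ‖L ν x‖ ^ 2 := by
    intro x
    have h1 : (inner ℂ x (h x)).im = 0 := by
      have h2 := hh.isSymmetric x x
      have h4 : (starRingEnd ℂ) (inner ℂ x (h x)) = inner ℂ x (h x) := by
        rw [inner_conj_symm]; exact h2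
      exact Complex.conj_eq_iff_im.mp h4
    have h5 : inner ℂ x (S x) = ((∑ ν, ‖L ν x‖ ^ 2 : ℝ) : ℂ) := by
      simp only [hS, sum_apply, inner_sum,
        mul_apply_eq_comp, ContinuousLinearMap.star_eq_adjoint,
        ContinuousLinearMap.adjoint_inner_right, inner_self_eq_norm_sq_to_K]
      push_cast
      rfl
    have h6 : inner ℂ x (G x) = -(Complex.I * inner ℂ x (h x)) - (1 / 2) * inner ℂ x (S x) := by
      simp [hG, inner_neg_right, inner_smul_right]
    have h7 : (1 / 2 : ℂ) = ((1 / 2 : ℝ) : ℂ) := by push_cast; rfl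
    rw [h6, h5, h7, RCLike.re_to_complex, Complex.sub_re, Complex.neg_re, Complex.I_mul_re, h1,
      Complex.re_ofReal_mul, Complex.ofReal_re]
    ring
  have hA : ∀ x, ∑ o, ‖A o x‖ ^ 2 ≤ (1 + s ^ 2 * ‖G‖ ^ 2) * ‖x‖ ^ 2 := by
    intro x
    rw [Fintype.sum_option]
    simp only [A, Option.elim_none, Option.elim_some]
    have h1 : ∀ ν, ‖(((√s : ℝ) : ℂ) • L ν) x‖ ^ 2 = s * ‖L ν x‖ ^ 2 := by
      intro ν
      rw [smul_apply, norm_smul, mul_pow, Complex.norm_real,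
        Real.norm_of_nonneg (Real.sqrt_nonneg s), Real.sq_sqrt hs]
    have h2 : ‖(1 + (s : ℂ) • G) x‖ ^ 2 =
        ‖x‖ ^ 2 - s * ∑ ν, ‖L ν x‖ ^ 2 + s ^ 2 * ‖G x‖ ^ 2 := by
      rw [add_apply, smul_apply,
        one_apply_eq_self, @norm_add_sq ℂ, inner_smul_right, RCLike.re_to_complex,
        Complex.re_ofReal_mul, norm_smul, Complex.norm_real, Real.norm_of_nonneg hs]
      have h3 := hre x
      rw [RCLike.re_to_complex] at h3
      rw [h3]
      ring
    rw [h2, Finset.sum_congr rfl fun ν _ => h1 ν, ← Finset.mul_sum]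
    have h4 : ‖G x‖ ^ 2 ≤ ‖G‖ ^ 2 * ‖x‖ ^ 2 := by
      rw [← mul_pow]
      exact pow_le_pow_left₀ (norm_nonneg _) (G.le_opNorm x) 2
    nlinarith [mul_le_mul_of_nonneg_left h4 (sq_nonneg s)]
  have h1 := norm_kraus_le A (by positivity) hA O
  have h2 : ‖((s : ℂ) ^ 2) • (star G * O * G)‖ ≤ s ^ 2 * (‖G‖ ^ 2 * ‖O‖) := by
    rw [norm_smul, norm_pow, Complex.norm_real, Real.norm_of_nonneg hs]
    gcongr
    calc ‖star G * O * G‖ ≤ ‖star G‖ * ‖O‖ * ‖G‖ := norm_mul₃_le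
      _ = ‖G‖ ^ 2 * ‖O‖ := by rw [norm_star]; ring
  rw [hΦ]
  calc _ ≤ _ := norm_sub_le _ _
    _ ≤ (1 + s ^ 2 * ‖G‖ ^ 2) * ‖O‖ + s ^ 2 * (‖G‖ ^ 2 * ‖O‖) := add_le_add h1 h2
    _ = _ := by ring

end Kraus

/-! ### A differential inequality for norms -/

open Set Filter Topology in
/-- If `g' = p + ρ`, where moving in the direction `p x` does not increase the norm of `g x` to
first order, then `‖g‖` grows at most at the rate `‖ρ‖`. The comparison is with a function `B` with
derivative at least `‖ρ‖`, so `ρ` need not be measurable and no integral is involved. -/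
theorem norm_le_of_hasDerivWithinAt_firstOrderContractive {E : Type*} [NormedAddCommGroup E]
    [NormedSpace ℝ E] {b : ℝ} {g p ρ : ℝ → E} {B B' : ℝ → ℝ}
    (hg : ContinuousOn g (Icc 0 b))
    (hg' : ∀ x ∈ Ico 0 b, HasDerivWithinAt g (p x + ρ x) (Ici x) x)
    (hp : ∀ x ∈ Ico 0 b, ∃ C : ℝ, ∀ s, 0 ≤ s → ‖g x + s • p x‖ ≤ ‖g x‖ + C * s ^ 2)
    (hρ : ∀ x ∈ Ico 0 b, ‖ρ x‖ ≤ B' x)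
    (h0 : ‖g 0‖ ≤ B 0) (hB : ∀ x, HasDerivAt B (B' x) x) :
    ∀ x ∈ Icc 0 b, ‖g x‖ ≤ B x := by
  refine image_le_of_liminf_slope_right_le_deriv_boundary hg.norm h0
    (fun x _ => (hB x).continuousAt.continuousWithinAt) (fun x _ => (hB x).hasDerivWithinAt)
    fun x hx r hr => ?_
  obtain ⟨C, hC⟩ := hp x hx
  have hd := (hasDerivWithinAt_iff_isLittleO.1 (hg' x hx))
  have hε : 0 < (r - B' x) / 2 := by linarith
  have h1 : ∀ᶠ z in 𝓝[>] x, ‖g z - g x - (z - x) • (p x + ρ x)‖ ≤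
      (r - B' x) / 2 * ‖z - x‖ :=
    (hd.def hε).filter_mono (nhdsWithin_mono x Ioi_subset_Ici_self)
  have h2 : ∀ᶠ z in 𝓝[>] x, C * (z - x) < (r - B' x) / 2 := by
    have : Tendsto (fun z => C * (z - x)) (𝓝[>] x) (𝓝 (C * (x - x))) :=
      ((continuous_const.mul (continuous_id.sub continuous_const)).tendsto x).mono_left
        nhdsWithin_le_nhds
    rw [sub_self, mul_zero] at this
    exact this.eventually_lt_const hε
  refine Eventually.frequently ?_
  filter_upwards [h1, h2, self_mem_nhdsWithin] with z hz1 hz2 hz3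
  have hzx : 0 < z - x := sub_pos.2 hz3
  rw [slope_def_field, div_lt_iff₀ hzx]
  rw [Real.norm_of_nonneg hzx.le] at hz1
  have h3 : g z = (g z - g x - (z - x) • (p x + ρ x)) + (g x + (z - x) • p x) +
      (z - x) • ρ x := by module
  have h4 : ‖g z‖ ≤ (r - B' x) / 2 * (z - x) + (‖g x‖ + C * (z - x) ^ 2) +
      (z - x) * B' x := by
    rw [h3]
    refine (norm_add₃_le).trans (add_le_add (add_le_add hz1 (hC _ hzx.le)) ?_)
    rw [norm_smul, Real.norm_of_nonneg hzx.le]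
    exact mul_le_mul_of_nonneg_left (hρ x hx) hzx.le
  nlinarith [mul_lt_mul_of_pos_right hz2 hzx]

/-! ### Locality of Liouvillians -/

section Locality

variable {Λ : Type*} [Fintype Λ] [DecidableEq Λ] {ι : Λ → Type*} [∀ z, Fintype (ι z)]
  [∀ z, DecidableEq (ι z)]

theorem SupportedOn.star {V : Finset Λ} {O : Op ι} (hO : SupportedOn V O) :
    SupportedOn V (star O) := by
  classical
  obtain ⟨A, rfl⟩ := hO
  refine ⟨Matrix.toEuclideanCLM (n := Config ι V) (𝕜 := ℂ)
    (Star.star ((Matrix.toEuclideanCLM (n := Config ι V) (𝕜 := ℂ)).symm A)),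
    (map_star Matrix.toEuclideanCLM _).symm.trans (congrArg _ ?_)⟩
  rw [StarAlgEquiv.symm_apply_apply]
  ext x y
  rw [Matrix.star_apply, Matrix.of_apply, Matrix.of_apply, Matrix.star_apply]
  by_cases h : ∀ z, z ∉ V → x z = y z
  · rw [if_pos h, if_pos fun z hz => (h z hz).symm]
  · rw [if_neg h, if_neg fun h' => h fun z hz => (h' z hz).symm, star_zero]

open Classical in
/-- The matrix entries of `(A ⊗ 1)(1 ⊗ B)` for disjoint subsystems. At most one intermediate
configuration contributes: it agrees with `y` on `X` and with `x` elsewhere. -/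
theorem embedMatrix_mul_apply {X Y : Finset Λ} (hXY : Disjoint X Y)
    (A : Matrix (Config ι X) (Config ι X) ℂ) (B : Matrix (Config ι Y) (Config ι Y) ℂ)
    (x y : (z : Λ) → ι z) :
    ∑ w : (z : Λ) → ι z,
      (if ∀ z, z ∉ X → x z = w z then A (fun z => x z) (fun z => w z) else 0) *
      (if ∀ z, z ∉ Y → w z = y z then B (fun z => w z) (fun z => y z) else 0) =
    if ∀ z, z ∉ X → z ∉ Y → x z = y z then
      A (fun z => x z) (fun z => y z) * B (fun z => x z) (fun z => y z) else 0 := by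
  set w₀ : (z : Λ) → ι z := fun z => if z ∈ X then y z else x z with hw₀
  have hnX : ∀ z, z ∈ Y → z ∉ X := fun z hz hz' => Finset.disjoint_left.1 hXY hz' hz
  rw [Finset.sum_eq_single w₀]
  · have h1 : ∀ z, z ∉ X → x z = w₀ z := fun z hz => by simp [hw₀, hz]
    have h2 : (fun z : X => w₀ z) = fun z : X => y z := by
      funext z; simp [hw₀]
    have h3 : (fun z : Y => w₀ z) = fun z : Y => x z := by
      funext z; simp [hw₀, hnX z z.2]
    rw [if_pos h1, h2, h3]
    by_cases h : ∀ z, z ∉ X → z ∉ Y → x z = y z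
    · rw [if_pos h, if_pos]
      intro z hz
      by_cases hzX : z ∈ X
      · simp [hw₀, hzX]
      · simp [hw₀, hzX, h z hzX hz]
    · rw [if_neg h, if_neg, mul_zero]
      intro h'
      refine h fun z hzX hzY => ?_
      rw [h1 z hzX, h' z hzY]
  · intro w _ hw
    by_cases h1 : ∀ z, z ∉ X → x z = w z
    · rw [if_neg (c := ∀ z, z ∉ Y → w z = y z), mul_zero]
      intro h2
      refine hw (funext fun z => ?_)
      by_cases hz : z ∈ X
      · simpa [hw₀, hz] using h2 z (fun h => hnX z h hz)
      · simpa [hw₀, hz] using (h1 z hz).symm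
    · rw [if_neg h1, zero_mul]
  · intro h; exact absurd (Finset.mem_univ _) h

theorem SupportedOn.commute {X Y : Finset Λ} (hXY : Disjoint X Y) {P Q : Op ι}
    (hP : SupportedOn X P) (hQ : SupportedOn Y Q) : Commute P Q := by
  classical
  obtain ⟨A, rfl⟩ := hP
  obtain ⟨B, rfl⟩ := hQ
  refine (map_mul Matrix.toEuclideanCLM _ _).symm.trans
    ((congrArg _ ?_).trans (map_mul Matrix.toEuclideanCLM _ _))
  ext x y
  simp only [Matrix.mul_apply, Matrix.of_apply]
  rw [embedMatrix_mul_apply hXY, embedMatrix_mul_apply hXY.symm]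
  refine if_congr ⟨fun h z h1 h2 => h z h2 h1, fun h z h1 h2 => h z h2 h1⟩ (mul_comm _ _) rfl

/-- A Liouvillian is a bimodule map over the operators on any disjoint subsystem. -/
theorem Liouvillians.map_mul_of_disjoint {X Y : Finset Λ} (hXY : Disjoint X Y) {T : SuperOp ι}
    (hT : T ∈ Liouvillians ι X) {P : Op ι} (hP : SupportedOn Y P) (O : Op ι) :
    T (P * O) = P * T O ∧ T (O * P) = T O * P := by
  obtain ⟨h, m, L, hh, -, hL, hT⟩ := hT
  have c1 : h * P = P * h := hh.commute hXY hP
  have c2 : ∀ ν, L ν * P = P * L ν := fun ν => (hL ν).commute hXY hP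
  have c3 : ∀ ν, star (L ν) * P = P * star (L ν) := fun ν => (hL ν).star.commute hXY hP
  have c1' : ∀ R, h * (P * R) = P * (h * R) := fun R => by
    rw [← mul_assoc, c1, mul_assoc]
  have c2' : ∀ ν R, L ν * (P * R) = P * (L ν * R) := fun ν R => by
    rw [← mul_assoc, c2, mul_assoc]
  have c3' : ∀ ν R, star (L ν) * (P * R) = P * (star (L ν) * R) := fun ν R => by
    rw [← mul_assoc, c3, mul_assoc]
  constructor
  · simp only [hT, mul_add, mul_sub, mul_smul_comm, Finset.mul_sum, mul_assoc, c1', c2', c3']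
  · simp only [hT, add_mul, sub_mul, smul_mul_assoc, Finset.sum_mul, mul_assoc, c1, c2, c3']

theorem Liouvillians.map_one {X : Finset Λ} {T : SuperOp ι} (hT : T ∈ Liouvillians ι X) :
    T 1 = 0 := by
  obtain ⟨h, m, L, -, -, -, hT⟩ := hT
  rw [hT]
  have : ∀ ν, star (L ν) * 1 * L ν -
      (1 / 2 : ℂ) • (star (L ν) * L ν * 1 + 1 * (star (L ν) * L ν)) = 0 := by
    intro ν
    rw [mul_one, mul_one, one_mul]
    module
  rw [Finset.sum_eq_zero fun ν _ => this ν, mul_one, one_mul, sub_self, smul_zero, add_zero]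

theorem Liouvillians.apply_eq_zero_of_disjoint {X Y : Finset Λ} (hXY : Disjoint X Y)
    {T : SuperOp ι} (hT : T ∈ Liouvillians ι X) {O : Op ι} (hO : SupportedOn Y O) : T O = 0 := by
  have h := (Liouvillians.map_mul_of_disjoint hXY hT hO 1).1
  rwa [mul_one, Liouvillians.map_one hT, mul_zero] at h

/-- `S` is a combination of maps `O ↦ P O Q` with `P`, `Q` supported on `X`, and `T` commutes with
left and right multiplication by such operators. -/
theorem Liouvillians.comm_of_disjoint {X Y : Finset Λ} (hXY : Disjoint X Y)
    {S T : SuperOp ι} (hS : S ∈ Liouvillians ι X) (hT : T ∈ Liouvillians ι Y) (O : Op ι) :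
    S (T O) = T (S O) := by
  have hl : ∀ {P} (_ : SupportedOn X P) (O), T (P * O) = P * T O := fun hP O =>
    (Liouvillians.map_mul_of_disjoint hXY.symm hT hP O).1
  have hr : ∀ {P} (_ : SupportedOn X P) (O), T (O * P) = T O * P := fun hP O =>
    (Liouvillians.map_mul_of_disjoint hXY.symm hT hP O).2
  obtain ⟨h, m, L, hh, -, hL, hS⟩ := hS
  have hLs := fun ν => (hL ν).star
  rw [hS, hS]
  simp only [map_add, map_sub, map_smul, map_sum, ← mul_assoc, hr hh, hl hh, hr (hL _),
    hr (hLs _), hl (hLs _)]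
  simp only [mul_assoc, hl (hLs _), hl (hL _)]

theorem Liouvillians.firstOrderContractive {X : Finset Λ} {T : SuperOp ι}
    (hT : T ∈ Liouvillians ι X) : FirstOrderContractive T := by
  obtain ⟨h, m, L, -, hh, -, hT⟩ := hT
  exact firstOrderContractive_lindblad hh L T hT

end Locality

/-! ### Counting chains of interaction supports -/

section Chains

variable {Λ : Type*} [DecidableEq Λ]

/-- The number of chains `Z₁, …, Z_k` in `𝒮` leading from `X` to `Y`: `Z₁` meets `X`, consecutive
members meet, and `Z_k` meets `Y` (for `k = 0`: `X` meets `Y`). -/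
def chainCount (𝒮 : Finset (Finset Λ)) (Y : Finset Λ) : ℕ → Finset Λ → ℕ
  | 0, X => if (X ∩ Y).Nonempty then 1 else 0
  | k + 1, X => ∑ Z ∈ 𝒮 with (Z ∩ X).Nonempty, chainCount 𝒮 Y k Z

variable {𝒮 : Finset (Finset Λ)} {X Y : Finset Λ}

/-- A chain of `k` sets of diameter at most `a` covers a distance of at most `k * a`. -/
theorem exists_dist_le_of_chainCount_ne_zero [MetricSpace Λ] {a : ℝ}
    (ha : ∀ Z ∈ 𝒮, Metric.diam (Z : Set Λ) ≤ a) {k : ℕ} (h : chainCount 𝒮 Y k X ≠ 0) :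
    ∃ x ∈ X, ∃ y ∈ Y, dist x y ≤ k * a := by
  induction k generalizing X with
  | zero =>
    have hne : (X ∩ Y).Nonempty := by
      by_contra hne
      exact h (if_neg hne)
    obtain ⟨x, hx⟩ := hne
    rw [Finset.mem_inter] at hx
    exact ⟨x, hx.1, x, hx.2, by simp⟩
  | succ k ih =>
    obtain ⟨Z, hZ, hZk⟩ := Finset.exists_ne_zero_of_sum_ne_zero h
    rw [Finset.mem_filter] at hZ
    obtain ⟨z, hz, y, hy, hzy⟩ := ih hZk
    obtain ⟨x, hx⟩ := hZ.2
    rw [Finset.mem_inter] at hx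
    refine ⟨x, hx.2, y, hy, ?_⟩
    have h1 : dist x z ≤ a :=
      (Metric.dist_le_diam_of_mem Z.finite_toSet.isBounded hx.1 hz).trans (ha Z hZ.1)
    have h2 := dist_triangle x z y
    push_cast
    linarith

variable {D : ℕ}

theorem chainCount_le_pow (hD : ∀ Z ∈ 𝒮, #{Z' ∈ 𝒮 | (Z' ∩ Z).Nonempty} ≤ D) (k : ℕ)
    (hX : X ∈ 𝒮) : chainCount 𝒮 Y k X ≤ D ^ k := by
  induction k generalizing X with
  | zero =>
    rw [pow_zero, chainCount]
    split_ifs <;> simp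
  | succ k ih =>
    calc chainCount 𝒮 Y (k + 1) X
        ≤ #{Z' ∈ 𝒮 | (Z' ∩ X).Nonempty} • D ^ k :=
          Finset.sum_le_card_nsmul _ _ _ fun Z hZ => ih (Finset.mem_filter.1 hZ).1
      _ ≤ D * D ^ k := by rw [smul_eq_mul]; gcongr; exact hD X hX
      _ = D ^ (k + 1) := (pow_succ' D k).symm

theorem chainCount_succ_le_start (hD : ∀ Z ∈ 𝒮, #{Z' ∈ 𝒮 | (Z' ∩ Z).Nonempty} ≤ D) (k : ℕ) :
    chainCount 𝒮 Y (k + 1) X ≤ #{Z ∈ 𝒮 | (Z ∩ X).Nonempty} * D ^ k :=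
  Finset.sum_le_card_nsmul _ _ _ fun _ hZ => chainCount_le_pow hD k (Finset.mem_filter.1 hZ).1

/-- Chains ending at `Y`, with free initial link, are counted from their last member backwards: each
further link has at most `D` choices because intersecting is a symmetric relation. -/
theorem sum_chainCount_le (hD : ∀ Z ∈ 𝒮, #{Z' ∈ 𝒮 | (Z' ∩ Z).Nonempty} ≤ D) (k : ℕ) :
    ∑ Z ∈ 𝒮, chainCount 𝒮 Y k Z ≤ #{Z ∈ 𝒮 | (Z ∩ Y).Nonempty} * D ^ k := by
  induction k with
  | zero =>
    rw [pow_zero, mul_one, Finset.card_filter]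
    rfl
  | succ k ih =>
    calc ∑ Z ∈ 𝒮, chainCount 𝒮 Y (k + 1) Z
        = ∑ Z ∈ 𝒮, ∑ Z' ∈ 𝒮, if (Z' ∩ Z).Nonempty then chainCount 𝒮 Y k Z' else 0 :=
          Finset.sum_congr rfl fun Z _ => Finset.sum_filter _ _
      _ = ∑ Z' ∈ 𝒮, #{Z ∈ 𝒮 | (Z ∩ Z').Nonempty} * chainCount 𝒮 Y k Z' := by
          rw [Finset.sum_comm]
          refine Finset.sum_congr rfl fun Z' _ => ?_
          rw [← Finset.sum_filter, Finset.sum_const, smul_eq_mul]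
          simp only [Finset.inter_comm]
      _ ≤ ∑ Z' ∈ 𝒮, D * chainCount 𝒮 Y k Z' :=
          Finset.sum_le_sum fun Z' hZ' => Nat.mul_le_mul_right _ (hD Z' hZ')
      _ = D * ∑ Z' ∈ 𝒮, chainCount 𝒮 Y k Z' := by rw [Finset.mul_sum]
      _ ≤ D * (#{Z ∈ 𝒮 | (Z ∩ Y).Nonempty} * D ^ k) := Nat.mul_le_mul_left _ ih
      _ = _ := by rw [pow_succ]; ring

theorem chainCount_succ_le_end (hD : ∀ Z ∈ 𝒮, #{Z' ∈ 𝒮 | (Z' ∩ Z).Nonempty} ≤ D) (k : ℕ) :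
    chainCount 𝒮 Y (k + 1) X ≤ #{Z ∈ 𝒮 | (Z ∩ Y).Nonempty} * D ^ k :=
  (Finset.sum_le_sum_of_subset (Finset.filter_subset _ _)).trans (sum_chainCount_le hD k)

theorem pos_of_chainCount_succ_ne_zero
    (hD : ∀ Z ∈ 𝒮, #{Z' ∈ 𝒮 | (Z' ∩ Z).Nonempty} ≤ D) {k : ℕ}
    (h : chainCount 𝒮 Y (k + 1) X ≠ 0) : 0 < D := by
  obtain ⟨Z, hZ, -⟩ := Finset.exists_ne_zero_of_sum_ne_zero h
  rw [Finset.mem_filter] at hZ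
  refine lt_of_lt_of_le (Finset.card_pos.2 ⟨Z, ?_⟩) (hD Z hZ.1)
  rw [Finset.mem_filter, Finset.inter_self]
  exact ⟨hZ.1, hZ.2.mono Finset.inter_subset_left⟩

theorem chainCount_le_of_disjoint (hXY : Disjoint X Y)
    (hD : ∀ Z ∈ 𝒮, #{Z' ∈ 𝒮 | (Z' ∩ Z).Nonempty} ≤ D) (k : ℕ) :
    (chainCount 𝒮 Y k X : ℝ) ≤
      min ((#{Z ∈ 𝒮 | (Z ∩ X).Nonempty} : ℝ) / D) ((#{Z ∈ 𝒮 | (Z ∩ Y).Nonempty} : ℝ) / D) *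
        (D : ℝ) ^ k := by
  rcases eq_or_ne (chainCount 𝒮 Y k X) 0 with h | h
  · rw [h, Nat.cast_zero]
    positivity
  cases k with
  | zero =>
    refine absurd (if_neg ?_) h
    rwa [Finset.not_nonempty_iff_eq_empty, ← Finset.disjoint_iff_inter_eq_empty]
  | succ k =>
    have hDpos : (0 : ℝ) < D := Nat.cast_pos.2 (pos_of_chainCount_succ_ne_zero hD h)
    have key : ∀ c : ℕ, chainCount 𝒮 Y (k + 1) X ≤ c * D ^ k →
        (chainCount 𝒮 Y (k + 1) X : ℝ) ≤ (c : ℝ) / D * (D : ℝ) ^ (k + 1) := by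
      intro c hc
      have h1 : (c : ℝ) / D * (D : ℝ) ^ (k + 1) = c * D ^ k := by
        rw [pow_succ]; field_simp
      rw [h1]
      exact_mod_cast hc
    rw [min_mul_of_nonneg _ _ (by positivity)]
    exact le_min (key _ (chainCount_succ_le_start hD k)) (key _ (chainCount_succ_le_end hD k))

end Chains

/-! ### The chain expansion -/

section Expansion

theorem hasDerivAt_pow_div_factorial (c u : ℝ) (k : ℕ) :
    HasDerivAt (fun u => (c * u) ^ (k + 1) / (k + 1).factorial)
      (c * ((c * u) ^ k / k.factorial)) u := by
  have h := ((((hasDerivAt_id u).const_mul c).pow (k + 1)).div_const ((k + 1).factorial : ℝ))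
  refine h.congr_deriv ?_
  have : (k.factorial : ℝ) ≠ 0 := by positivity
  rw [Nat.factorial_succ]
  simp only [id, Nat.add_sub_cancel]
  push_cast
  field_simp

variable {Λ : Type*} [DecidableEq Λ]

/-- The truncated chain expansion: the first `n` terms of `∑ (c u) ^ k / k!` weighted by the number
of chains of length `k` from `X` to `Y`, plus a remainder in which chains of length `n` are counted
crudely, irrespective of `Y`, by `#𝒮 ^ n`. -/
noncomputable def chainBound (𝒮 : Finset (Finset Λ)) (Y : Finset Λ) (c : ℝ) (n : ℕ)
    (X : Finset Λ) (u : ℝ) : ℝ :=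
  ∑ k ∈ Finset.range n, chainCount 𝒮 Y k X * ((c * u) ^ k / k.factorial) +
    (#𝒮 * c * u) ^ n / n.factorial

variable {𝒮 : Finset (Finset Λ)} {X Y : Finset Λ}

theorem chainBound_nonneg {c u : ℝ} (hc : 0 ≤ c) (hu : 0 ≤ u) (n : ℕ) :
    0 ≤ chainBound 𝒮 Y c n X u := by
  unfold chainBound
  positivity

theorem hasDerivAt_chainBound_succ (c : ℝ) (n : ℕ) (u : ℝ) :
    HasDerivAt (chainBound 𝒮 Y c (n + 1) X)
      (c * ∑ k ∈ Finset.range n, chainCount 𝒮 Y (k + 1) X * ((c * u) ^ k / k.factorial) +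
        #𝒮 * c * ((#𝒮 * c * u) ^ n / n.factorial)) u := by
  have h1 : ∀ k, HasDerivAt
      (fun u => chainCount 𝒮 Y (k + 1) X * ((c * u) ^ (k + 1) / (k + 1).factorial : ℝ))
      (chainCount 𝒮 Y (k + 1) X * (c * ((c * u) ^ k / k.factorial))) u :=
    fun k => (hasDerivAt_pow_div_factorial c u k).const_mul _
  have h2 := ((HasDerivAt.fun_sum fun k (_ : k ∈ Finset.range n) => h1 k).add_const
    (chainCount 𝒮 Y 0 X : ℝ)).add (hasDerivAt_pow_div_factorial (#𝒮 * c) u n)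
  refine (h2.congr_deriv ?_).congr_of_eventuallyEq (Filter.Eventually.of_forall fun u => ?_)
  · rw [Finset.mul_sum]
    congr 1
    exact Finset.sum_congr rfl fun k _ => by ring
  · simp [chainBound, Finset.sum_range_succ']

/-- Prepending a link to the chains: the sum over all first links of the bounds of order `n` is
controlled by the derivative of the bound of order `n + 1`, up to the factor `c`
(compare `hasDerivAt_chainBound_succ`). -/
theorem sum_chainBound_le {c u : ℝ} (hc : 0 ≤ c) (hu : 0 ≤ u) (n : ℕ) :
    ∑ Z ∈ 𝒮 with (Z ∩ X).Nonempty, chainBound 𝒮 Y c n Z u ≤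
      ∑ k ∈ Finset.range n, chainCount 𝒮 Y (k + 1) X * ((c * u) ^ k / k.factorial) +
        #𝒮 * ((#𝒮 * c * u) ^ n / n.factorial) := by
  unfold chainBound
  rw [Finset.sum_add_distrib, Finset.sum_comm]
  refine add_le_add (le_of_eq (Finset.sum_congr rfl fun k _ => ?_)) ?_
  · rw [← Finset.sum_mul, chainCount, Nat.cast_sum]
  · rw [Finset.sum_const, nsmul_eq_mul]
    gcongr
    exact Finset.filter_subset _ _

end Expansion

section Evolution

variable {Λ : Type*} [Fintype Λ] [DecidableEq Λ] {ι : Λ → Type*} [∀ z, Fintype (ι z)]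
  [∀ z, DecidableEq (ι z)]

open Set in
/-- Chain expansion of an evolved observable. The terms of the generator with support disjoint from
`X` commute with `K` and so act contractively on `K (F u)`; the remaining terms act as a source
`K (M Z u (F u))`, to which the bound of the preceding order applies with `M Z u` in place
of `K`. -/
theorem norm_apply_le_chainBound {𝒮 : Finset (Finset Λ)} {Y : Finset Λ} {c b : ℝ}
    {M : Finset Λ → ℝ → SuperOp ι} {F : ℝ → Op ι}
    (hM : ∀ Z u, M Z u ∈ Liouvillians ι Z) (hM0 : ∀ Z ∉ 𝒮, ∀ u, M Z u = 0)
    (hMc : ∀ Z u, ‖M Z u‖ ≤ c) (hF0 : SupportedOn Y (F 0))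
    (hF : ∀ u, 0 ≤ u → HasDerivWithinAt F ((∑ Z, M Z u) (F u)) (Ici 0) u)
    (n : ℕ) {X : Finset Λ} {K : SuperOp ι} (hK : K ∈ Liouvillians ι X) :
    ∀ u ∈ Icc 0 b, ‖K (F u)‖ ≤ ‖K‖ * ‖F 0‖ * chainBound 𝒮 Y c n X u := by
  have hc : 0 ≤ c := (norm_nonneg _).trans (hMc ∅ 0)
  have hFc : ContinuousOn F (Icc 0 b) := fun u hu =>
    (hF u hu.1).continuousWithinAt.mono Icc_subset_Ici_self
  have hreal : ∀ (s : ℝ) (A : Op ι), (s : ℂ) • A = s • A := fun s A => Complex.coe_smul s A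
  have hcontr : ∀ {T : SuperOp ι} (A : Op ι), FirstOrderContractive T →
      ∃ C : ℝ, ∀ s, 0 ≤ s → ‖A + s • T A‖ ≤ ‖A‖ + C * s ^ 2 := by
    rintro T A ⟨C, hC⟩
    refine ⟨C * ‖A‖, fun s hs => ?_⟩
    rw [← hreal]
    exact (hC s hs A).trans (le_of_eq (by ring))
  induction n generalizing X K with
  | zero =>
    -- the bound of order zero says that the whole evolution is contractive
    intro u hu
    have h1 : ‖F u‖ ≤ ‖F 0‖ := by
      refine norm_le_of_hasDerivWithinAt_firstOrderContractive (ρ := fun _ => 0)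
        (B := fun _ => ‖F 0‖) (B' := fun _ => 0) hFc
        (p := fun x => (∑ Z, M Z x) (F x)) (fun x hx => ?_) (fun x _ => hcontr _ ?_)
        (fun _ _ => by simp) le_rfl (fun x => hasDerivAt_const _ _) u hu
      · rw [add_zero]
        exact (hF x hx.1).mono (Ici_subset_Ici.2 hx.1)
      · exact .sum _ fun Z _ => Liouvillians.firstOrderContractive (hM Z x)
    have h2 : chainBound 𝒮 Y c 0 X u = 1 := by simp [chainBound]
    rw [h2, mul_one]
    exact (K.le_opNorm _).trans (by gcongr)
  | succ n ih =>
    refine norm_le_of_hasDerivWithinAt_firstOrderContractive (g := fun u => K (F u))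
      (p := fun x => (∑ Z with ¬ (Z ∩ X).Nonempty, M Z x) (K (F x)))
      (ρ := fun x => ∑ Z with (Z ∩ X).Nonempty, K (M Z x (F x)))
      (K.continuous.comp_continuousOn hFc) (fun x hx => ?_) (fun x _ => hcontr _ ?_)
      (fun x hx => ?_) ?_
      (fun x => (hasDerivAt_chainBound_succ c n x).const_mul (‖K‖ * ‖F 0‖))
    · have h1 := (K.restrictScalars ℝ).hasFDerivAt.comp_hasDerivWithinAt x
        ((hF x hx.1).mono (Ici_subset_Ici.2 hx.1))
      refine h1.congr_deriv ?_
      change K ((∑ Z, M Z x) (F x)) = _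
      rw [sum_apply, sum_apply, map_sum, ← Finset.sum_filter_add_sum_filter_not Finset.univ
        (fun Z : Finset Λ => (Z ∩ X).Nonempty), add_comm]
      congr 1
      refine Finset.sum_congr rfl fun Z hZ => ?_
      refine Liouvillians.comm_of_disjoint ?_ hK (hM Z x) _
      rw [Finset.mem_filter, Finset.not_nonempty_iff_eq_empty,
        ← Finset.disjoint_iff_inter_eq_empty] at hZ
      exact hZ.2.symm
    · exact .sum _ fun Z _ => Liouvillians.firstOrderContractive (hM Z x)
    · have hx' : x ∈ Icc 0 b := Ico_subset_Icc_self hx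
      have h1 : ∑ Z with (Z ∩ X).Nonempty, K (M Z x (F x)) =
          ∑ Z ∈ 𝒮 with (Z ∩ X).Nonempty, K (M Z x (F x)) := by
        refine (Finset.sum_subset (Finset.filter_subset_filter _ (Finset.subset_univ _))
          fun Z hZ hZ' => ?_).symm
        have : Z ∉ 𝒮 := fun h => hZ' (Finset.mem_filter.2 ⟨h, (Finset.mem_filter.1 hZ).2⟩)
        rw [hM0 Z this, zero_apply, map_zero]
      rw [h1]
      calc ‖∑ Z ∈ 𝒮 with (Z ∩ X).Nonempty, K (M Z x (F x))‖
          ≤ ∑ Z ∈ 𝒮 with (Z ∩ X).Nonempty, ‖K‖ * ‖F 0‖ * c * chainBound 𝒮 Y c n Z x := by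
            refine norm_sum_le_of_le _ fun Z _ => ?_
            have h2 := ih (hM Z x) x hx'
            have h3 := chainBound_nonneg (𝒮 := 𝒮) (Y := Y) (X := Z) hc hx'.1 n
            calc ‖K (M Z x (F x))‖ ≤ ‖K‖ * ‖M Z x (F x)‖ := K.le_opNorm _
              _ ≤ ‖K‖ * (c * ‖F 0‖ * chainBound 𝒮 Y c n Z x) := by
                gcongr
                exact h2.trans (by gcongr; exact hMc Z x)
              _ = _ := by ring
        _ = ‖K‖ * ‖F 0‖ * (c * ∑ Z ∈ 𝒮 with (Z ∩ X).Nonempty, chainBound 𝒮 Y c n Z x) := by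
            rw [← Finset.mul_sum]; ring
        _ ≤ ‖K‖ * ‖F 0‖ * (c * (∑ k ∈ Finset.range n,
              chainCount 𝒮 Y (k + 1) X * ((c * x) ^ k / k.factorial) +
              #𝒮 * ((#𝒮 * c * x) ^ n / n.factorial))) := by
            gcongr
            exact sum_chainBound_le hc hx'.1 n
        _ = _ := by ring
    · have h1 : chainBound 𝒮 Y c (n + 1) X 0 = chainCount 𝒮 Y 0 X := by
        simp [chainBound, Finset.sum_range_succ']
      rw [h1]
      by_cases h : (X ∩ Y).Nonempty
      · rw [chainCount, if_pos h, Nat.cast_one, mul_one]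
        exact K.le_opNorm _
      · rw [Finset.not_nonempty_iff_eq_empty, ← Finset.disjoint_iff_inter_eq_empty] at h
        rw [Liouvillians.apply_eq_zero_of_disjoint h hK hF0, norm_zero]
        positivity

end Evolution

/-! ### Chains and the geometry of the interaction -/

section Geometry

variable {Λ : Type*} [Fintype Λ] [DecidableEq Λ] {ι : Λ → Type*} [∀ z, Fintype (ι z)]

/-- The sets `Z` with `ℓ_Z ≠ 0`. -/
noncomputable def activeSupports (ℓ : Finset Λ → ℝ → SuperOp ι) : Finset (Finset Λ) :=
  open Classical in {Z | ℓ Z ≠ 0}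

theorem mem_activeSupports {ℓ : Finset Λ → ℝ → SuperOp ι} {Z : Finset Λ} :
    Z ∈ activeSupports ℓ ↔ ℓ Z ≠ 0 := by
  simp [activeSupports]

theorem card_neighbors_le_neighborNumber (ℓ : Finset Λ → ℝ → SuperOp ι) :
    ∀ Z ∈ activeSupports ℓ,
      #{Z' ∈ activeSupports ℓ | (Z' ∩ Z).Nonempty} ≤ neighborNumber ℓ := by
  intro Z hZ
  refine le_csSup (Set.Finite.bddAbove ?_) ⟨Z, mem_activeSupports.1 hZ, ?_⟩
  · refine (Set.finite_range fun Z : Finset Λ =>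
      {Z' : Finset Λ | ℓ Z' ≠ 0 ∧ (Z' ∩ Z).Nonempty}.ncard).subset ?_
    rintro _ ⟨Z, -, rfl⟩
    exact ⟨Z, rfl⟩
  · rw [← Set.ncard_coe_finset]
    congr 1
    ext Z'
    simp [mem_activeSupports]

theorem card_neighbors_le_vol_extension (ℓ : Finset Λ → ℝ → SuperOp ι) (X : Finset Λ) :
    #{Z ∈ activeSupports ℓ | (Z ∩ X).Nonempty} ≤ vol ℓ (extension ℓ X) := by
  rw [← Set.ncard_coe_finset]
  refine Set.ncard_le_ncard (fun Z hZ => ?_) (Set.toFinite _)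
  rw [Finset.mem_coe, Finset.mem_filter, mem_activeSupports] at hZ
  exact ⟨fun z hz => ⟨Z, hZ.1, hZ.2, hz⟩, hZ.1⟩

theorem min_card_neighbors_le_prefactor (ℓ : Finset Λ → ℝ → SuperOp ι) (X Y : Finset Λ) :
    min ((#{Z ∈ activeSupports ℓ | (Z ∩ X).Nonempty} : ℝ) / neighborNumber ℓ)
      ((#{Z ∈ activeSupports ℓ | (Z ∩ Y).Nonempty} : ℝ) / neighborNumber ℓ) ≤
      prefactor ℓ X Y := by
  unfold prefactor
  gcongr <;> exact card_neighbors_le_vol_extension ℓ _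

theorem prefactor_nonneg (ℓ : Finset Λ → ℝ → SuperOp ι) (X Y : Finset Λ) :
    0 ≤ prefactor ℓ X Y := by
  unfold prefactor
  positivity

theorem norm_le_normBound {ℓ : Finset Λ → ℝ → SuperOp ι}
    (hbdd : BddAbove (Set.range fun p : Finset Λ × ℝ => ‖ℓ p.1 p.2‖)) (Z : Finset Λ) (t : ℝ) :
    ‖ℓ Z t‖ ≤ normBound ℓ :=
  le_ciSup hbdd (Z, t)

variable [MetricSpace Λ]

theorem diam_le_interactionRange (ℓ : Finset Λ → ℝ → SuperOp ι) :
    ∀ Z ∈ activeSupports ℓ, Metric.diam (Z : Set Λ) ≤ interactionRange ℓ := by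
  intro Z hZ
  refine le_csSup (Set.Finite.bddAbove ?_) ⟨Z, mem_activeSupports.1 hZ, rfl⟩
  refine (Set.finite_range fun Z : Finset Λ => Metric.diam (Z : Set Λ)).subset ?_
  rintro _ ⟨Z, -, rfl⟩
  exact ⟨Z, rfl⟩

theorem interactionRange_nonneg (ℓ : Finset Λ → ℝ → SuperOp ι) : 0 ≤ interactionRange ℓ := by
  refine Real.sSup_nonneg ?_
  rintro _ ⟨Z, -, rfl⟩
  exact Metric.diam_nonneg

theorem setDist_le_dist {Λ : Type*} [MetricSpace Λ] {X Y : Finset Λ} {x y : Λ}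
    (hx : x ∈ X) (hy : y ∈ Y) :
    setDist X Y ≤ dist x y :=
  ciInf_le (f := fun p : X × Y => dist (p.1 : Λ) (p.2 : Λ)) (Set.finite_range _).bddBelow
    (⟨x, hx⟩, ⟨y, hy⟩)

theorem chainCount_eq_zero_of_interactionRange_eq_zero {ℓ : Finset Λ → ℝ → SuperOp ι}
    (ha : interactionRange ℓ = 0) {X Y : Finset Λ} (hXY : Disjoint X Y) (k : ℕ) :
    chainCount (activeSupports ℓ) Y k X = 0 := by
  by_contra h
  obtain ⟨x, hx, y, hy, hxy⟩ :=
    exists_dist_le_of_chainCount_ne_zero (diam_le_interactionRange ℓ) h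
  rw [ha, mul_zero, dist_le_zero] at hxy
  exact Finset.disjoint_left.1 hXY hx (hxy ▸ hy)

/-- A chain of length `k` exists only if `d(X,Y) / a ≤ k`, so the factor `exp (k - d(X,Y) / a)` can
be inserted; this is the source of the number `e` in the velocity. For `a = 0` the quotient
`d(X,Y) / a` is `0`, and the inequality still holds. -/
theorem chainCount_le_prefactor_mul {ℓ : Finset Λ → ℝ → SuperOp ι} {X Y : Finset Λ}
    (hXY : Disjoint X Y) (k : ℕ) :
    (chainCount (activeSupports ℓ) Y k X : ℝ) ≤
      prefactor ℓ X Y * Real.exp (-(setDist X Y / interactionRange ℓ)) *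
        (Real.exp 1 * neighborNumber ℓ) ^ k := by
  have hV := prefactor_nonneg ℓ X Y
  rcases eq_or_ne (chainCount (activeSupports ℓ) Y k X) 0 with h | h
  · rw [h, Nat.cast_zero]
    positivity
  obtain ⟨x, hx, y, hy, hxy⟩ :=
    exists_dist_le_of_chainCount_ne_zero (diam_le_interactionRange ℓ) h
  have h1 : setDist X Y / interactionRange ℓ ≤ k :=
    div_le_of_le_mul₀ (interactionRange_nonneg ℓ) (Nat.cast_nonneg k)
      ((setDist_le_dist hx hy).trans hxy)
  have h2 : 1 ≤ Real.exp (-(setDist X Y / interactionRange ℓ)) * Real.exp 1 ^ k := by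
    rw [← Real.exp_nat_mul, ← Real.exp_add, Real.one_le_exp_iff]
    linarith
  calc (chainCount (activeSupports ℓ) Y k X : ℝ)
      ≤ prefactor ℓ X Y * (neighborNumber ℓ : ℝ) ^ k :=
        (chainCount_le_of_disjoint hXY (card_neighbors_le_neighborNumber ℓ) k).trans
          (by gcongr; exact min_card_neighbors_le_prefactor ℓ X Y)
    _ ≤ prefactor ℓ X Y * (neighborNumber ℓ : ℝ) ^ k *
        (Real.exp (-(setDist X Y / interactionRange ℓ)) * Real.exp 1 ^ k) :=
        le_mul_of_one_le_right (by positivity) h2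
    _ = _ := by rw [mul_pow]; ring

end Geometry

open Filter Topology in
/-- The remainder of the chain expansion tends to zero. -/
theorem le_mul_of_forall_le_chainBound {Λ : Type*} [DecidableEq Λ] {𝒮 : Finset (Finset Λ)}
    {X Y : Finset Λ} {q A c b S : ℝ} (hA : 0 ≤ A)
    (hq : ∀ n, q ≤ A * chainBound 𝒮 Y c n X b)
    (hS : ∀ n, ∑ k ∈ Finset.range n, chainCount 𝒮 Y k X * ((c * b) ^ k / k.factorial) ≤ S) :
    q ≤ A * S := by
  have h1 : Tendsto (fun n : ℕ => A * (S + (#𝒮 * c * b) ^ n / n.factorial)) atTop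
      (𝓝 (A * (S + 0))) :=
    ((FloorSemiring.tendsto_pow_div_factorial_atTop (#𝒮 * c * b)).const_add S).const_mul A
  rw [add_zero] at h1
  refine ge_of_tendsto' h1 fun n => (hq n).trans ?_
  unfold chainBound
  gcongr
  exact hS n

end MarkovLattice

/-! ### The Lieb-Robinson bound -/

open MarkovLattice in
theorem theorem1 {Λ : Type*} [Fintype Λ] [DecidableEq Λ] [MetricSpace Λ]
    {ι : Λ → Type*} [∀ z, Fintype (ι z)] [∀ z, DecidableEq (ι z)]
    (ℓ : Finset Λ → ℝ → MarkovLattice.SuperOp ι)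
    (hℓ : ∀ Z t, ℓ Z t ∈ MarkovLattice.Liouvillians ι Z)
    (hbdd : BddAbove (Set.range fun p : Finset Λ × ℝ => ‖ℓ p.1 p.2‖))
    (τ : ℝ → ℝ → MarkovLattice.SuperOp ι)
    (hτ : MarkovLattice.IsPropagator (MarkovLattice.totalLiouvillian ℓ) τ)
    (X Y : Finset Λ)
    (hXY : Disjoint X Y ∨ 1 ≤ MarkovLattice.prefactor ℓ X Y)
    (K : MarkovLattice.SuperOp ι) (hK : K ∈ MarkovLattice.Liouvillians ι X)
    (O : MarkovLattice.Op ι) (hO : MarkovLattice.SupportedOn Y O)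
    (r t : ℝ) (hrt : r ≤ t) :
    ‖K (τ r t O)‖ ≤ MarkovLattice.prefactor ℓ X Y * ‖K‖ * ‖O‖ *
        Real.exp (MarkovLattice.velocity ℓ * (t - r) -
          MarkovLattice.setDist X Y / MarkovLattice.interactionRange ℓ) ∧
      (MarkovLattice.interactionRange ℓ = 0 → Disjoint X Y → K (τ r t O) = 0) := by
  have hb : 0 ≤ t - r := sub_nonneg.2 hrt
  have hc : 0 ≤ normBound ℓ := (norm_nonneg _).trans (norm_le_normBound hbdd ∅ 0)
  have hF0 : τ (t - 0) t O = O := by rw [sub_zero, hτ.1]; rfl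
  -- in the backward time `u = t - r` the evolved observable solves a forward equation
  have hF : ∀ u, 0 ≤ u → HasDerivWithinAt (fun u => τ (t - u) t O)
      ((∑ Z, ℓ Z (t - u)) (τ (t - u) t O)) (Set.Ici 0) u := by
    intro u hu
    have h1 : HasDerivWithinAt (fun u => t - u) (-1 : ℝ) (Set.Ici 0) u :=
      ((hasDerivAt_id u).const_sub t).hasDerivWithinAt
    have h2 := (hτ.2 (t - u) t (by linarith)).scomp u h1
      (fun w (hw : 0 ≤ w) => show t - w ≤ t by linarith)
    have h3 := ((ContinuousLinearMap.apply ℂ (Op ι) O).restrictScalars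
      ℝ).hasFDerivAt.comp_hasDerivWithinAt u h2
    refine h3.congr_deriv ?_
    rw [neg_one_smul, neg_neg]
    rfl
  have key : ∀ n, ‖K (τ r t O)‖ ≤
      ‖K‖ * ‖O‖ * chainBound (activeSupports ℓ) Y (normBound ℓ) n X (t - r) := by
    intro n
    have h := norm_apply_le_chainBound (𝒮 := activeSupports ℓ) (Y := Y) (b := t - r)
      (M := fun Z u => ℓ Z (t - u)) (fun Z u => hℓ Z _)
      (fun Z hZ u => by rw [mem_activeSupports, not_not] at hZ; rw [hZ]; rfl)
      (fun Z u => norm_le_normBound hbdd Z _) (hF0.symm ▸ hO) hF n hK (t - r) ⟨hb, le_rfl⟩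
    rwa [hF0, sub_sub_cancel] at h
  refine ⟨?_, fun ha hdisj => ?_⟩
  · by_cases hdisj : Disjoint X Y
    · have h := le_mul_of_forall_le_chainBound (by positivity) key (S := prefactor ℓ X Y *
        Real.exp (velocity ℓ * (t - r) - setDist X Y / interactionRange ℓ)) fun n => ?_
      · exact h.trans (le_of_eq (by ring))
      have hV := prefactor_nonneg ℓ X Y
      calc ∑ k ∈ Finset.range n, chainCount (activeSupports ℓ) Y k X *
            ((normBound ℓ * (t - r)) ^ k / k.factorial)
          ≤ ∑ k ∈ Finset.range n, prefactor ℓ X Y *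
              Real.exp (-(setDist X Y / interactionRange ℓ)) *
              (Real.exp 1 * neighborNumber ℓ) ^ k *
              ((normBound ℓ * (t - r)) ^ k / k.factorial) := by
            gcongr
            exact chainCount_le_prefactor_mul hdisj _
        _ = prefactor ℓ X Y * Real.exp (-(setDist X Y / interactionRange ℓ)) *
              ∑ k ∈ Finset.range n, (velocity ℓ * (t - r)) ^ k / k.factorial := by
            rw [Finset.mul_sum]
            refine Finset.sum_congr rfl fun k _ => ?_
            simp only [velocity, mul_pow]
            ring
        _ ≤ prefactor ℓ X Y * Real.exp (-(setDist X Y / interactionRange ℓ)) *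
              Real.exp (velocity ℓ * (t - r)) := by
            gcongr
            refine Real.sum_le_exp_of_nonneg ?_ n
            unfold velocity
            positivity
        _ = _ := by rw [mul_assoc, ← Real.exp_add]; ring_nf
    -- for intersecting `X` and `Y` the contraction bound suffices
    · have hV : 1 ≤ prefactor ℓ X Y := hXY.resolve_left hdisj
      obtain ⟨x, hxX, hxY⟩ := Finset.not_disjoint_iff.1 hdisj
      have h1 : setDist X Y / interactionRange ℓ ≤ 0 :=
        div_nonpos_of_nonpos_of_nonneg ((setDist_le_dist hxX hxY).trans_eq (dist_self x))
          (interactionRange_nonneg ℓ)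
      have h2 : 1 ≤ Real.exp (velocity ℓ * (t - r) - setDist X Y / interactionRange ℓ) := by
        rw [Real.one_le_exp_iff]
        have : 0 ≤ velocity ℓ * (t - r) := by unfold velocity; positivity
        linarith
      have h3 := key 0
      rw [show chainBound (activeSupports ℓ) Y (normBound ℓ) 0 X (t - r) = 1 by
        simp [chainBound], mul_one] at h3
      calc ‖K (τ r t O)‖ ≤ 1 * (‖K‖ * ‖O‖) * 1 := by rwa [one_mul, mul_one]
        _ ≤ prefactor ℓ X Y * (‖K‖ * ‖O‖) *
            Real.exp (velocity ℓ * (t - r) - setDist X Y / interactionRange ℓ) := by gcongr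
        _ = _ := by ring
  · have h := le_mul_of_forall_le_chainBound (by positivity) key (S := 0) fun n => by
      simp [chainCount_eq_zero_of_interactionRange_eq_zero ha hdisj]
    rw [mul_zero] at h
    exact norm_le_zero_iff.1 h
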